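/- Let $n\ge 1$ be an integer, let $a<0$ and let $c=n\pi/2$. For a symmetric $n\times n$ matrix $A$ with eigenvalues $\lambda_1,\dots,\lambda_n$ (with multiplicity) write $\theta(A)=\sum_{i=1}^n\arctan\lambda_i$, and write $B_r\subset\mathbb R^n$ for the open ball of radius $r$ centered at the origin. Then there exist $r>0$, depending on $n$ and $a$, and a convex function $u:B_r\to\mathbb R$ such that: 1. $u$ is a viscosity solution on $B_r$ of the rotator equation $$\theta(D^2u)=c+\frac a2\left(|x|^2+|Du|^2\right),$$ i.e. $u$ is continuous on $B_r$ and, whenever $x_0\in B_r$ and $\varphi$ is a function that is $C^2$ near $x_0$ with $\varphi(x_0)=u(x_0)$, one has $\theta(D^2\varphi(x_0))\ge c+\frac a2(|x_0|^2+|D\varphi(x_0)|^2)$ if $\varphi\ge u$ near $x_0$, and $\theta(D^2\varphi(x_0))\le c+\frac a2(|x_0|^2+|D\varphi(x_0)|^2)$ if $\varphi\le u$ near $x_0$; 2. $u\in C^{1,1/3}(B_r)$, i.e. $u$ is $C^1$ on $B_r$ and $Du$ is uniformly Hölder continuous on $B_r$ with exponent $1/3$; 3. $u\in C^\infty(B_r\setminus\{0\})$;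 4. $u$ is singular at the origin: $Du$ is not differentiable at $0$ (in particular $u$ is not $C^2$ in any neighborhood of $0$). -/

import Mathlib

open scoped NNReal ContDiff Topology

/-- The Lagrangian angle `tr arctan A = ∑ arctan λᵢ`, the sum running over the real eigenvalues of
`A` with multiplicity, i.e. over the real roots of the characteristic polynomial. For a symmetric
matrix these are all `n` eigenvalues, see `lagrangianAngle_eq_sum`. -/
noncomputable def lagrangianAngle {n : ℕ} (A : Matrix (Fin n) (Fin n) ℝ) : ℝ :=
  (A.charpoly.roots.map Real.arctan).sum

theorem lagrangianAngle_eq_sum {n : ℕ} {A : Matrix (Fin n) (Fin n) ℝ} (hA : A.IsHermitian) :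
    lagrangianAngle A = ∑ i, Real.arctan (hA.eigenvalues i) := by
  rw [lagrangianAngle, hA.roots_charpoly_eq_eigenvalues]
  simp [List.sum_ofFn]

/-- The Hessian matrix `(∂ᵢ∂ⱼ φ)(x)`. -/
noncomputable def hessianMatrix {n : ℕ} (φ : EuclideanSpace ℝ (Fin n) → ℝ)
    (x : EuclideanSpace ℝ (Fin n)) : Matrix (Fin n) (Fin n) ℝ :=
  Matrix.of fun i j =>
    fderiv ℝ (fderiv ℝ φ) x (EuclideanSpace.single i 1) (EuclideanSpace.single j 1)

/-- `u` is a viscosity subsolution of `∑ arctan λᵢ(D²u) = ψ(x, u, Du)` on `Ω`: every `C²` function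
touching `u` from above at a point `x₀` of `Ω` satisfies
`∑ arctan λᵢ(D²φ(x₀)) ≥ ψ(x₀, u(x₀), Dφ(x₀))`. -/
def IsViscositySubsolution {n : ℕ}
    (ψ : EuclideanSpace ℝ (Fin n) → ℝ → EuclideanSpace ℝ (Fin n) → ℝ)
    (Ω : Set (EuclideanSpace ℝ (Fin n))) (u : EuclideanSpace ℝ (Fin n) → ℝ) : Prop :=
  ∀ x₀ ∈ Ω, ∀ φ : EuclideanSpace ℝ (Fin n) → ℝ, ContDiffAt ℝ 2 φ x₀ →
    φ x₀ = u x₀ → (∀ᶠ x in 𝓝 x₀, u x ≤ φ x) →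
    ψ x₀ (u x₀) (gradient φ x₀) ≤ lagrangianAngle (hessianMatrix φ x₀)

/-- `u` is a viscosity supersolution of `∑ arctan λᵢ(D²u) = ψ(x, u, Du)` on `Ω`: every `C²` function
touching `u` from below at a point `x₀` of `Ω` satisfies
`∑ arctan λᵢ(D²φ(x₀)) ≤ ψ(x₀, u(x₀), Dφ(x₀))`. -/
def IsViscositySupersolution {n : ℕ}
    (ψ : EuclideanSpace ℝ (Fin n) → ℝ → EuclideanSpace ℝ (Fin n) → ℝ)
    (Ω : Set (EuclideanSpace ℝ (Fin n))) (u : EuclideanSpace ℝ (Fin n) → ℝ) : Prop :=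
  ∀ x₀ ∈ Ω, ∀ φ : EuclideanSpace ℝ (Fin n) → ℝ, ContDiffAt ℝ 2 φ x₀ →
    φ x₀ = u x₀ → (∀ᶠ x in 𝓝 x₀, φ x ≤ u x) →
    lagrangianAngle (hessianMatrix φ x₀) ≤ ψ x₀ (u x₀) (gradient φ x₀)

/-- A continuous viscosity solution of `∑ arctan λᵢ(D²u) = ψ(x, u, Du)` on an open set `Ω`. -/
def IsViscositySolution {n : ℕ}
    (ψ : EuclideanSpace ℝ (Fin n) → ℝ → EuclideanSpace ℝ (Fin n) → ℝ)
    (Ω : Set (EuclideanSpace ℝ (Fin n))) (u : EuclideanSpace ℝ (Fin n) → ℝ) : Prop :=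
  ContinuousOn u Ω ∧ IsViscositySubsolution ψ Ω u ∧ IsViscositySupersolution ψ Ω u

/-- The Hölder class `C^{1,α}(Ω)` for a bounded open convex set `Ω` (such as a ball): `u` is `C¹` on
`Ω` and its gradient is uniformly `α`-Hölder there (so `u` and `Du` are automatically bounded). -/
def IsC1Holder {n : ℕ} (α : ℝ≥0) (Ω : Set (EuclideanSpace ℝ (Fin n)))
    (u : EuclideanSpace ℝ (Fin n) → ℝ) : Prop :=
  ContDiffOn ℝ 1 u Ω ∧ ∃ C : ℝ≥0, HolderOnWith C α (gradient u) Ω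

/-- The right-hand side `c + (a/2)(|x|² + |Du|²)` of the rotator equation. -/
noncomputable def rotatorPhase {n : ℕ} (a c : ℝ) (x : EuclideanSpace ℝ (Fin n)) (_s : ℝ)
    (p : EuclideanSpace ℝ (Fin n)) : ℝ :=
  c + a / 2 * (‖x‖ ^ 2 + ‖p‖ ^ 2)

/-!
For a radial function `u` in dimension `m + 1`, write the graph of the radial derivative in polar
coordinates as `(R sin φ(R), R cos φ(R))`. With `β = -a / 2` the rotator equation becomes the
singular ODE `R φ' = tan (β R² - (m + 1) φ)`. In terms of `y = β R² - (m + 1) φ` it reads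
`R y' + (m + 1) y = 2 β R² - (m + 1) (tan y - y)`, and the solution bounded at `0` is the fixed
point of a contraction, because such a solution is a weighted average of the right-hand side. Then
`φ` is of order `R²`, hence `s = R sin φ` is of order `R³` and `u' = R cos φ` of order
`s ^ (1 / 3)`. At the origin no `C²` function touches `u` from above, while touching from below
imposes no condition: the phase there is `(m + 1) π / 2`, an upper bound of the Lagrangian angle.
-/

section Eigenvalues

variable {𝕜 E : Type*} [RCLike 𝕜] [NormedAddCommGroup E] [InnerProductSpace 𝕜 E]

theorem exists_ne_zero_forall_inner_eq_zero {ι : Type*} [Fintype ι]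
    (b b' : OrthonormalBasis ι 𝕜 E) (S T : Finset ι) (h : S.card + T.card < Fintype.card ι) :
    ∃ v : E, v ≠ 0 ∧ (∀ i ∈ S, inner 𝕜 (b i) v = 0) ∧ ∀ i ∈ T, inner 𝕜 (b' i) v = 0 := by
  have : FiniteDimensional 𝕜 E := b.toBasis.finiteDimensional_of_finite
  let coords : E →ₗ[𝕜] (S → 𝕜) × (T → 𝕜) :=
    (LinearMap.pi fun i : S => innerₛₗ 𝕜 (b i)).prod (LinearMap.pi fun i : T => innerₛₗ 𝕜 (b' i))
  have hker : LinearMap.ker coords ≠ ⊥ := by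
    apply LinearMap.ker_ne_bot_of_finrank_lt
    simpa [Module.finrank_eq_card_basis b.toBasis] using h
  obtain ⟨v, hv, hv0⟩ := Submodule.exists_mem_ne_zero_of_ne_bot hker
  have hcoords : coords v = 0 := hv
  exact ⟨v, hv0, fun i hi => congrFun (congrArg Prod.fst hcoords) ⟨i, hi⟩,
    fun i hi => congrFun (congrArg Prod.snd hcoords) ⟨i, hi⟩⟩

variable [FiniteDimensional 𝕜 E] {T S : E →ₗ[𝕜] E} {n : ℕ}

theorem re_inner_apply_self_eq_sum_eigenvalues (hT : T.IsSymmetric)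
    (hn : Module.finrank 𝕜 E = n) (v : E) :
    RCLike.re (inner 𝕜 (T v) v) =
      ∑ i, hT.eigenvalues hn i * ‖inner 𝕜 (hT.eigenvectorBasis hn i) v‖ ^ 2 := by
  rw [← (hT.eigenvectorBasis hn).sum_inner_mul_inner, map_sum]
  refine Finset.sum_congr rfl fun i _ => ?_
  rw [hT, hT.apply_eigenvectorBasis, inner_smul_right, mul_assoc, RCLike.re_ofReal_mul,
    inner_mul_symm_re_eq_norm, norm_mul, norm_inner_symm, sq]

/-- **Weyl's monotonicity theorem**. -/
theorem eigenvalues_le_eigenvalues_of_re_inner_le (hT : T.IsSymmetric) (hS : S.IsSymmetric)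
    (hn : Module.finrank 𝕜 E = n)
    (h : ∀ v, RCLike.re (inner 𝕜 (T v) v) ≤ RCLike.re (inner 𝕜 (S v) v)) (i : Fin n) :
    hT.eigenvalues hn i ≤ hS.eigenvalues hn i := by
  -- A vector in the span of the top `i + 1` eigenvectors of `T` and of the bottom `n - i` of `S`.
  obtain ⟨v, hv, hvT, hvS⟩ := exists_ne_zero_forall_inner_eq_zero (hT.eigenvectorBasis hn)
    (hS.eigenvectorBasis hn) (Finset.Ioi i) (Finset.Iio i) (by simp; omega)
  have lower : hT.eigenvalues hn i * ‖v‖ ^ 2 ≤ RCLike.re (inner 𝕜 (T v) v) := by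
    rw [re_inner_apply_self_eq_sum_eigenvalues hT hn,
      ← (hT.eigenvectorBasis hn).sum_sq_norm_inner_right, Finset.mul_sum]
    refine Finset.sum_le_sum fun j _ => ?_
    rcases lt_or_ge i j with hij | hji
    · simp [hvT j (Finset.mem_Ioi.2 hij)]
    · gcongr
      exact hT.eigenvalues_antitone hn hji
  have upper : RCLike.re (inner 𝕜 (S v) v) ≤ hS.eigenvalues hn i * ‖v‖ ^ 2 := by
    rw [re_inner_apply_self_eq_sum_eigenvalues hS hn,
      ← (hS.eigenvectorBasis hn).sum_sq_norm_inner_right, Finset.mul_sum]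
    refine Finset.sum_le_sum fun j _ => ?_
    rcases lt_or_ge j i with hji | hij
    · simp [hvS j (Finset.mem_Iio.2 hji)]
    · gcongr
      exact hS.eigenvalues_antitone hn hij
  exact le_of_mul_le_mul_right (lower.trans ((h v).trans upper)) (by positivity)

end Eigenvalues

section LagrangianAngle

variable {n : ℕ}

theorem lagrangianAngle_mono {A B : Matrix (Fin n) (Fin n) ℝ} (hA : A.IsHermitian)
    (hB : B.IsHermitian) (h : ∀ v : EuclideanSpace ℝ (Fin n),
      inner ℝ (A.toEuclideanLin v) v ≤ inner ℝ (B.toEuclideanLin v) v) :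
    lagrangianAngle A ≤ lagrangianAngle B := by
  rw [lagrangianAngle_eq_sum hA, lagrangianAngle_eq_sum hB]
  exact Finset.sum_le_sum fun i _ => Real.arctan_strictMono.monotone
    (eigenvalues_le_eigenvalues_of_re_inner_le (Matrix.isSymmetric_toEuclideanLin_iff.2 hA)
      (Matrix.isSymmetric_toEuclideanLin_iff.2 hB) finrank_euclideanSpace h _)

theorem lagrangianAngle_le (A : Matrix (Fin n) (Fin n) ℝ) :
    lagrangianAngle A ≤ n * (Real.pi / 2) := by
  have hcard : A.charpoly.roots.card ≤ n := by simpa using A.charpoly.card_roots'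
  calc lagrangianAngle A ≤ (A.charpoly.roots.map Real.arctan).card • (Real.pi / 2) :=
        Multiset.sum_le_card_nsmul _ _ fun x hx => by
          obtain ⟨y, -, rfl⟩ := Multiset.mem_map.1 hx
          exact (Real.arctan_lt_pi_div_two y).le
    _ = A.charpoly.roots.card * (Real.pi / 2) := by rw [Multiset.card_map, nsmul_eq_mul]
    _ ≤ n * (Real.pi / 2) := by gcongr

open Polynomial in
theorem charpoly_scalar_add_vecMulVec {R ι : Type*} [CommRing R] [Fintype ι] [DecidableEq ι]
    [Nonempty ι] (α : R) (u v : ι → R) :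
    (Matrix.scalar ι α + Matrix.vecMulVec u v).charpoly =
      (X - C α) ^ (Fintype.card ι - 1) * (X - C (α + u ⬝ᵥ v)) := by
  have hshift := Matrix.charpoly_sub_scalar (Matrix.vecMulVec u v) (-α)
  rw [map_neg, sub_neg_eq_add, add_comm, Matrix.charpoly_vecMulVec] at hshift
  obtain ⟨m, hm⟩ := Nat.exists_eq_add_of_le' (Fintype.card_pos (α := ι))
  rw [hshift, hm]
  simp only [Nat.add_sub_cancel, smul_eq_C_mul, sub_comp, mul_comp, pow_comp, X_comp, C_comp,
    map_add, map_neg]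
  ring

theorem lagrangianAngle_scalar_add_vecMulVec {m : ℕ} (α : ℝ) (u v : Fin (m + 1) → ℝ) :
    lagrangianAngle (Matrix.scalar _ α + Matrix.vecMulVec u v) =
      Real.arctan (α + u ⬝ᵥ v) + m * Real.arctan α := by
  rw [lagrangianAngle, charpoly_scalar_add_vecMulVec, Polynomial.roots_mul
    (mul_ne_zero (pow_ne_zero _ (Polynomial.X_sub_C_ne_zero _)) (Polynomial.X_sub_C_ne_zero _)),
    Polynomial.roots_pow, Polynomial.roots_X_sub_C, Polynomial.roots_X_sub_C]
  simp [Multiset.map_nsmul, Multiset.sum_nsmul, add_comm]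

end LagrangianAngle

section SecondDerivative

theorem isLocalMin_sub_of_eventually_le {X : Type*} [TopologicalSpace X] {f g : X → ℝ} {x : X}
    (hx : f x = g x) (h : ∀ᶠ y in 𝓝 x, f y ≤ g y) : IsLocalMin (fun y => g y - f y) x := by
  filter_upwards [h] with y hy
  simpa [hx] using hy

variable {E : Type*} [NormedAddCommGroup E] [NormedSpace ℝ E] {f g : E → ℝ} {x : E}

theorem differentiableAt_fderiv_of_contDiffAt_two (hf : ContDiffAt ℝ 2 f x) :
    DifferentiableAt ℝ (fderiv ℝ f) x :=
  (hf.fderiv_right (m := 1) (by norm_num)).differentiableAt (by norm_num)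

theorem eventually_differentiableAt_of_contDiffAt_two (hf : ContDiffAt ℝ 2 f x) :
    ∀ᶠ y in 𝓝 x, DifferentiableAt ℝ f y :=
  (hf.eventually (by norm_num)).mono fun _ hy => hy.differentiableAt (by norm_num)

theorem deriv_deriv_comp_line (hf : ContDiffAt ℝ 2 f x) (v : E) :
    deriv (deriv fun t : ℝ => f (x + t • v)) 0 = fderiv ℝ (fderiv ℝ f) x v v := by
  have hline : ∀ t : ℝ, HasDerivAt (fun t : ℝ => x + t • v) v t := fun t => by
    simpa using ((hasDerivAt_id t).smul_const v).const_add x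
  have htendsto : Filter.Tendsto (fun t : ℝ => x + t • v) (𝓝 0) (𝓝 x) := by
    simpa using (hline 0).continuousAt.tendsto
  have hfirst : deriv (fun t : ℝ => f (x + t • v)) =ᶠ[𝓝 0] fun t => fderiv ℝ f (x + t • v) v := by
    filter_upwards [htendsto.eventually (eventually_differentiableAt_of_contDiffAt_two hf)]
      with t ht using (ht.hasFDerivAt.comp_hasDerivAt t (hline t)).deriv
  have hsecond : HasFDerivAt (fderiv ℝ f) (fderiv ℝ (fderiv ℝ f) x) (x + (0 : ℝ) • v) := by
    simpa using (differentiableAt_fderiv_of_contDiffAt_two hf).hasFDerivAt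
  have hcomp : HasDerivAt (fun t : ℝ => fderiv ℝ f (x + t • v)) (fderiv ℝ (fderiv ℝ f) x v) 0 :=
    hsecond.comp_hasDerivAt (0 : ℝ) (hline 0)
  exact hfirst.deriv_eq.trans
    ((ContinuousLinearMap.apply ℝ ℝ v).hasFDerivAt.comp_hasDerivAt (0 : ℝ) hcomp).deriv

theorem deriv_deriv_nonneg_of_isLocalMin {f : ℝ → ℝ} {x : ℝ} (h : IsLocalMin f x)
    (hc : ContinuousAt f x) : 0 ≤ deriv (deriv f) x := by
  -- Otherwise `x` is also a local maximum, so `f` is constant near `x`.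
  by_contra! hneg
  have hmax := isLocalMax_of_deriv_deriv_neg hneg h.deriv_eq_zero hc
  have hconst : f =ᶠ[𝓝 x] fun _ => f x := by
    filter_upwards [h, hmax] with y hge hle using le_antisymm hle hge
  have hzero : deriv (deriv f) x = 0 := by simpa using hconst.deriv.deriv_eq
  exact hneg.ne hzero

theorem fderiv_fderiv_nonneg_of_isLocalMin (h : IsLocalMin f x) (hf : ContDiffAt ℝ 2 f x)
    (v : E) : 0 ≤ fderiv ℝ (fderiv ℝ f) x v v := by
  have hline : ContinuousAt (fun t : ℝ => x + t • v) 0 := by fun_prop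
  have htendsto : Filter.Tendsto (fun t : ℝ => x + t • v) (𝓝 0) (𝓝 x) := by
    simpa using hline.tendsto
  rw [← deriv_deriv_comp_line hf]
  apply deriv_deriv_nonneg_of_isLocalMin
  · have hmin : ∀ᶠ t in 𝓝 (0 : ℝ), f x ≤ f (x + t • v) := htendsto.eventually h
    simpa [IsLocalMin, IsMinFilter] using hmin
  · have hcont : ContinuousAt f (x + (0 : ℝ) • v) := by simpa using hf.continuousAt
    exact ContinuousAt.comp (f := fun t : ℝ => x + t • v) hcont hline

theorem fderiv_eq_of_eventually_le (hf : DifferentiableAt ℝ f x) (hg : DifferentiableAt ℝ g x)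
    (hx : f x = g x) (h : ∀ᶠ y in 𝓝 x, f y ≤ g y) : fderiv ℝ f x = fderiv ℝ g x := by
  have hzero := (isLocalMin_sub_of_eventually_le hx h).fderiv_eq_zero
  rw [fderiv_fun_sub hg hf, sub_eq_zero] at hzero
  exact hzero.symm

theorem fderiv_fderiv_le_of_eventually_le (hf : ContDiffAt ℝ 2 f x) (hg : ContDiffAt ℝ 2 g x)
    (hx : f x = g x) (h : ∀ᶠ y in 𝓝 x, f y ≤ g y) (v : E) :
    fderiv ℝ (fderiv ℝ f) x v v ≤ fderiv ℝ (fderiv ℝ g) x v v := by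
  have hnonneg := fderiv_fderiv_nonneg_of_isLocalMin (isLocalMin_sub_of_eventually_le hx h)
    (hg.sub hf) v
  have hsub : fderiv ℝ (fun y => g y - f y) =ᶠ[𝓝 x] fun y => fderiv ℝ g y - fderiv ℝ f y := by
    filter_upwards [eventually_differentiableAt_of_contDiffAt_two hf,
      eventually_differentiableAt_of_contDiffAt_two hg] with y hfy hgy using fderiv_fun_sub hgy hfy
  rw [hsub.fderiv_eq, fderiv_fun_sub (differentiableAt_fderiv_of_contDiffAt_two hg)
    (differentiableAt_fderiv_of_contDiffAt_two hf)] at hnonneg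
  simpa using hnonneg

end SecondDerivative

section Viscosity

variable {n : ℕ} {f g : EuclideanSpace ℝ (Fin n) → ℝ} {x : EuclideanSpace ℝ (Fin n)}

theorem inner_toEuclideanLin_hessianMatrix (f : EuclideanSpace ℝ (Fin n) → ℝ)
    (x v : EuclideanSpace ℝ (Fin n)) :
    inner ℝ ((hessianMatrix f x).toEuclideanLin v) v = fderiv ℝ (fderiv ℝ f) x v v := by
  have hv : v = ∑ i, v i • EuclideanSpace.single i (1 : ℝ) := by
    simpa using ((EuclideanSpace.basisFun (Fin n) ℝ).sum_repr v).symm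
  have hexpand : fderiv ℝ (fderiv ℝ f) x v v = ∑ i, v i * ∑ j, v j * hessianMatrix f x i j := by
    conv_lhs => rw [hv]
    simp only [map_sum, map_smul, sum_apply, smul_apply, smul_eq_mul, hessianMatrix,
      Matrix.of_apply, Finset.mul_sum]
    rw [Finset.sum_comm]
    exact Finset.sum_congr rfl fun i _ => Finset.sum_congr rfl fun j _ => by ring
  rw [hexpand]
  simp [PiLp.inner_apply, Matrix.toLpLin_apply, Matrix.mulVec, dotProduct, mul_comm]

theorem isHermitian_hessianMatrix (hf : ContDiffAt ℝ 2 f x) : (hessianMatrix f x).IsHermitian := by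
  ext i j
  simpa [hessianMatrix] using
    (hf.isSymmSndFDerivAt (by simp)) (EuclideanSpace.single j 1) (EuclideanSpace.single i 1)

theorem lagrangianAngle_hessianMatrix_le_of_eventually_le (hf : ContDiffAt ℝ 2 f x)
    (hg : ContDiffAt ℝ 2 g x) (hx : f x = g x) (h : ∀ᶠ y in 𝓝 x, f y ≤ g y) :
    lagrangianAngle (hessianMatrix f x) ≤ lagrangianAngle (hessianMatrix g x) :=
  lagrangianAngle_mono (isHermitian_hessianMatrix hf) (isHermitian_hessianMatrix hg) fun v => by
    simpa only [inner_toEuclideanLin_hessianMatrix] using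
      fderiv_fderiv_le_of_eventually_le hf hg hx h v

theorem gradient_eq_of_eventually_le {F : Type*} [NormedAddCommGroup F] [InnerProductSpace ℝ F]
    [CompleteSpace F] {f g : F → ℝ} {x : F} (hf : DifferentiableAt ℝ f x)
    (hg : DifferentiableAt ℝ g x) (hx : f x = g x) (h : ∀ᶠ y in 𝓝 x, f y ≤ g y) :
    gradient f x = gradient g x := by
  rw [gradient, gradient, fderiv_eq_of_eventually_le hf hg hx h]

theorem isViscositySolution_of_isolated_singularity
    {ψ : EuclideanSpace ℝ (Fin n) → ℝ → EuclideanSpace ℝ (Fin n) → ℝ}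
    {Ω : Set (EuclideanSpace ℝ (Fin n))} {u : EuclideanSpace ℝ (Fin n) → ℝ}
    {p : EuclideanSpace ℝ (Fin n)} (hdiff : ∀ x ∈ Ω, DifferentiableAt ℝ u x)
    (hsmooth : ∀ x ∈ Ω \ {p}, ContDiffAt ℝ 2 u x)
    (hsol : ∀ x ∈ Ω \ {p}, lagrangianAngle (hessianMatrix u x) = ψ x (u x) (gradient u x))
    (habove : ∀ φ : EuclideanSpace ℝ (Fin n) → ℝ, ContDiffAt ℝ 2 φ p → φ p = u p →
      ¬ ∀ᶠ x in 𝓝 p, u x ≤ φ x)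
    (hphase : n * (Real.pi / 2) ≤ ψ p (u p) (gradient u p)) :
    IsViscositySolution ψ Ω u := by
  refine ⟨fun x hx => (hdiff x hx).continuousAt.continuousWithinAt,
    fun x hx φ hφ hφx hle => ?_, fun x hx φ hφ hφx hle => ?_⟩
  · rcases eq_or_ne x p with rfl | hxp
    · exact absurd hle (habove φ hφ hφx)
    · rw [← gradient_eq_of_eventually_le (hdiff x hx) (hφ.differentiableAt two_ne_zero) hφx.symm
        hle, ← hsol x ⟨hx, hxp⟩]
      exact lagrangianAngle_hessianMatrix_le_of_eventually_le (hsmooth x ⟨hx, hxp⟩) hφ hφx.symm hle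
  · rw [gradient_eq_of_eventually_le (hφ.differentiableAt two_ne_zero) (hdiff x hx) hφx hle]
    rcases eq_or_ne x p with rfl | hxp
    · exact (lagrangianAngle_le _).trans hphase
    · rw [← hsol x ⟨hx, hxp⟩]
      exact lagrangianAngle_hessianMatrix_le_of_eventually_le hφ (hsmooth x ⟨hx, hxp⟩) hφx hle

theorem isC1Holder_of_holderOnWith_gradient {Ω : Set (EuclideanSpace ℝ (Fin n))}
    {u : EuclideanSpace ℝ (Fin n) → ℝ} {C α : ℝ≥0} (hΩ : IsOpen Ω) (hα : 0 < α)
    (hdiff : DifferentiableOn ℝ u Ω) (hholder : HolderOnWith C α (gradient u) Ω) :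
    IsC1Holder α Ω u := by
  refine ⟨?_, C, hholder⟩
  rw [← zero_add (1 : WithTop ℕ∞), contDiffOn_succ_iff_fderiv_of_isOpen hΩ]
  refine ⟨hdiff, by simp, ?_⟩
  rw [contDiffOn_zero, ← toDual_comp_gradient]
  exact (InnerProductSpace.toDual ℝ _).continuous.comp_continuousOn (hholder.continuousOn hα)

end Viscosity

section SingularODE

/-- The weighted average of `f` over the segment from `0` to `x`. It is the solution of the Euler
equation `x y' + (m + 1) y = f` that stays bounded at the singular point `0`. -/
noncomputable def eulerAverage (m : ℕ) (f : ℝ → ℝ) (x : ℝ) : ℝ :=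
  ∫ t in (0 : ℝ)..1, t ^ m * f (t * x)

variable {m : ℕ} {f g : ℝ → ℝ} {x : ℝ}

theorem continuous_eulerAverage (hf : Continuous f) : Continuous (eulerAverage m f) :=
  intervalIntegral.continuous_parametric_intervalIntegral_of_continuous' (by fun_prop) 0 1

theorem eulerAverage_sub (hf : Continuous f) (hg : Continuous g) :
    eulerAverage m (f - g) x = eulerAverage m f x - eulerAverage m g x := by
  simp only [eulerAverage, Pi.sub_apply, mul_sub]
  exact intervalIntegral.integral_sub (Continuous.intervalIntegrable (by fun_prop) _ _)
    (Continuous.intervalIntegrable (by fun_prop) _ _)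

theorem eulerAverage_le_eulerAverage (hf : Continuous f) (hg : Continuous g)
    (h : ∀ t ∈ Set.Icc (0 : ℝ) 1, f (t * x) ≤ g (t * x)) :
    eulerAverage m f x ≤ eulerAverage m g x :=
  intervalIntegral.integral_mono_on zero_le_one
    (Continuous.intervalIntegrable (by fun_prop) _ _)
    (Continuous.intervalIntegrable (by fun_prop) _ _)
    fun t ht => mul_le_mul_of_nonneg_left (h t ht) (pow_nonneg ht.1 m)

theorem eulerAverage_congr {δ : ℝ} (hfg : Set.EqOn f g (Set.Icc 0 δ)) (hx : x ∈ Set.Icc 0 δ) :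
    eulerAverage m f x = eulerAverage m g x := by
  refine intervalIntegral.integral_congr fun t ht => ?_
  rw [Set.uIcc_of_le zero_le_one] at ht
  simp only [hfg ⟨mul_nonneg ht.1 hx.1, (mul_le_of_le_one_left hx.1 ht.2).trans hx.2⟩]

theorem eulerAverage_const_mul (c : ℝ) (f : ℝ → ℝ) (x : ℝ) :
    eulerAverage m (fun s => c * f s) x = c * eulerAverage m f x := by
  simp only [eulerAverage, mul_left_comm _ c, intervalIntegral.integral_const_mul]

theorem eulerAverage_pow (m k : ℕ) (x : ℝ) :
    eulerAverage m (fun s => s ^ k) x = x ^ k / (m + k + 1) := by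
  simp only [eulerAverage, mul_pow, ← mul_assoc, ← pow_add, intervalIntegral.integral_mul_const,
    integral_pow]
  simp [div_eq_inv_mul]

theorem eulerAverage_const (m : ℕ) (c x : ℝ) : eulerAverage m (fun _ => c) x = c / (m + 1) := by
  simpa [div_eq_mul_inv] using
    (eulerAverage_const_mul (m := m) c (fun s => s ^ 0) x).trans
      (congrArg (c * ·) (eulerAverage_pow m 0 x))

theorem abs_eulerAverage_le (hf : Continuous f) {D : ℝ} (hD : ∀ s, |f s| ≤ D) :
    |eulerAverage m f x| ≤ D / (m + 1) := by
  rw [abs_le, ← neg_div, ← eulerAverage_const m D x, ← eulerAverage_const m (-D) x]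
  exact ⟨eulerAverage_le_eulerAverage continuous_const hf fun t _ => (abs_le.1 (hD _)).1,
    eulerAverage_le_eulerAverage hf continuous_const fun t _ => (abs_le.1 (hD _)).2⟩

theorem eulerAverage_eq_integral_div (m : ℕ) (f : ℝ → ℝ) (hx : x ≠ 0) :
    eulerAverage m f x = (∫ s in (0 : ℝ)..x, s ^ m * f s) / x ^ (m + 1) := by
  have hsubst := intervalIntegral.integral_comp_mul_right (a := 0) (b := 1)
    (fun s : ℝ => s ^ m * f s) hx
  simp only [zero_mul, one_mul, mul_pow, mul_right_comm _ (x ^ m),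
    intervalIntegral.integral_mul_const, smul_eq_mul] at hsubst
  rw [eq_div_iff (pow_ne_zero _ hx), pow_succ, ← mul_assoc, eulerAverage, hsubst]
  field_simp

theorem hasDerivAt_eulerAverage (hf : Continuous f) (hx : x ≠ 0) :
    HasDerivAt (eulerAverage m f) ((f x - (m + 1) * eulerAverage m f x) / x) x := by
  have hquot : eulerAverage m f =ᶠ[𝓝 x] fun y => (∫ s in (0 : ℝ)..y, s ^ m * f s) / y ^ (m + 1) :=
    (eventually_ne_nhds hx).mono fun y hy => eulerAverage_eq_integral_div m f hy
  have hint : HasDerivAt (fun y => ∫ s in (0 : ℝ)..y, s ^ m * f s) (x ^ m * f x) x :=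
    ((by fun_prop : Continuous fun s : ℝ => s ^ m * f s).integral_hasStrictDerivAt 0 x).hasDerivAt
  refine ((hint.div (hasDerivAt_pow (m + 1) x) (pow_ne_zero _ hx)).congr_of_eventuallyEq
    hquot).congr_deriv ?_
  rw [eulerAverage_eq_integral_div m f hx]
  push_cast
  field_simp
  ring

open scoped BoundedContinuousFunction

/-- `eulerAverage` as a map of the Banach space of bounded continuous functions. -/
noncomputable def boundedEulerAverage (m : ℕ) (f : ℝ →ᵇ ℝ) : ℝ →ᵇ ℝ :=
  .ofNormedAddCommGroup (eulerAverage m f) (continuous_eulerAverage f.continuous) (‖f‖ / (m + 1))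
    fun _ => abs_eulerAverage_le f.continuous f.norm_coe_le_norm

theorem dist_boundedEulerAverage_le (m : ℕ) (f g : ℝ →ᵇ ℝ) :
    dist (boundedEulerAverage m f) (boundedEulerAverage m g) ≤ dist f g / (m + 1) := by
  refine (BoundedContinuousFunction.dist_le (by positivity)).2 fun x => ?_
  rw [Real.dist_eq]
  change |eulerAverage m f x - eulerAverage m g x| ≤ _
  rw [← eulerAverage_sub f.continuous g.continuous]
  exact abs_eulerAverage_le (f.continuous.sub g.continuous) fun s => f.dist_coe_le_dist s

/-- The Picard map of the singular equation `x y' + (m + 1) (y + q(y)) = g`: its fixed points are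
the bounded solutions. -/
noncomputable def eulerPicard (m : ℕ) (g q y : ℝ →ᵇ ℝ) : ℝ →ᵇ ℝ :=
  boundedEulerAverage m (g - ((m : ℝ) + 1) • q.compContinuous y)

theorem eulerPicard_apply (m : ℕ) (g q y : ℝ →ᵇ ℝ) (x : ℝ) :
    eulerPicard m g q y x = eulerAverage m (fun s => g s - (m + 1) * q (y s)) x :=
  rfl

variable {g q : ℝ →ᵇ ℝ} {K : ℝ≥0}

theorem contractingWith_eulerPicard (hK : K < 1) (hq : LipschitzWith K q) :
    ContractingWith K (eulerPicard m g q) := by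
  refine ⟨hK, LipschitzWith.of_dist_le_mul fun y z => ?_⟩
  refine (dist_boundedEulerAverage_le m _ _).trans ((div_le_iff₀ (by positivity)).2 ?_)
  refine (BoundedContinuousFunction.dist_le (by positivity)).2 fun x => ?_
  calc dist (g x - (m + 1) * q (y x)) (g x - (m + 1) * q (z x))
      = dist (q (y x)) (q (z x)) * (m + 1) := by
        rw [dist_sub_left, Real.dist_eq, ← mul_sub, abs_mul, mul_comm, Real.dist_eq,
          abs_of_nonneg (by positivity : (0 : ℝ) ≤ m + 1)]
    _ ≤ K * dist y z * (m + 1) := by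
        gcongr
        exact (hq.dist_le_mul _ _).trans (by gcongr; exact y.dist_coe_le_dist x)

theorem eulerPicard_mem_Icc (hq : LipschitzWith K q) (hq_zero : q 0 = 0)
    (hq_nonneg : ∀ y, 0 ≤ y → 0 ≤ q y) {y : ℝ →ᵇ ℝ} (hy : ∀ x, y x ∈ Set.Icc 0 (g x / (m + 1)))
    (x : ℝ) : eulerPicard m g q y x ∈ Set.Icc ((1 - K) * eulerAverage m g x)
      (eulerAverage m g x) := by
  have hqy : ∀ s, (m + 1) * q (y s) ≤ K * g s := fun s => by
    have hlip : q (y s) ≤ K * y s := by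
      simpa [hq_zero, abs_of_nonneg (hy s).1, abs_of_nonneg (hq_nonneg _ (hy s).1)] using
        hq.dist_le_mul (y s) 0
    calc (m + 1) * q (y s) ≤ (m + 1) * (K * (g s / (m + 1))) := by
          gcongr
          exact hlip.trans (mul_le_mul_of_nonneg_left (hy s).2 K.coe_nonneg)
      _ = K * g s := by field_simp
  have hcont : Continuous fun s => g s - (m + 1) * q (y s) := by fun_prop
  rw [eulerPicard_apply, ← eulerAverage_const_mul]
  refine ⟨eulerAverage_le_eulerAverage (by fun_prop) hcont fun t _ => ?_,
    eulerAverage_le_eulerAverage hcont g.continuous fun t _ => ?_⟩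
  · linarith [hqy (t * x)]
  · have := hq_nonneg _ (hy (t * x)).1
    exact sub_le_self _ (by positivity)

theorem exists_eq_eulerAverage (m : ℕ) (hK : K < 1) (hq : LipschitzWith K q) (hq_zero : q 0 = 0)
    (hq_nonneg : ∀ y, 0 ≤ y → 0 ≤ q y) (hg_nonneg : ∀ x, 0 ≤ g x)
    (hg_le : ∀ x, ∀ t ∈ Set.Icc (0 : ℝ) 1, g (t * x) ≤ g x) :
    ∃ y : ℝ → ℝ, Continuous y ∧ y = eulerAverage m (fun s => g s - (m + 1) * q (y s)) ∧
      ∀ x, y x ∈ Set.Icc ((1 - K) * eulerAverage m g x) (eulerAverage m g x) := by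
  have hcontr := contractingWith_eulerPicard (m := m) (g := g) hK hq
  set y := hcontr.fixedPoint
  have hfixed : eulerPicard m g q y = y := hcontr.fixedPoint_isFixedPt
  let P : Set (ℝ →ᵇ ℝ) := {y | ∀ x, y x ∈ Set.Icc 0 (g x / (m + 1))}
  have hP_closed : IsClosed P := by
    simp only [P, Set.ofPred_forall]
    exact isClosed_iInter fun x => isClosed_Icc.preimage
      (by fun_prop : Continuous fun y : ℝ →ᵇ ℝ => y x)
  have hP_maps : Set.MapsTo (eulerPicard m g q) P P := fun z hz x => by
    obtain ⟨hlower, hupper⟩ := eulerPicard_mem_Icc hq hq_zero hq_nonneg hz x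
    have havg_nonneg : 0 ≤ eulerAverage m g x := by
      simpa [eulerAverage_const] using eulerAverage_le_eulerAverage (m := m) (x := x)
        (continuous_const (y := (0 : ℝ))) g.continuous fun t _ => hg_nonneg _
    have havg_le : eulerAverage m g x ≤ g x / (m + 1) := by
      simpa [eulerAverage_const] using eulerAverage_le_eulerAverage (m := m) (x := x)
        g.continuous (continuous_const (y := g x)) (hg_le x)
    have hK_le : 0 ≤ 1 - (K : ℝ) := sub_nonneg.2 (by exact_mod_cast hK.le)
    exact ⟨(mul_nonneg hK_le havg_nonneg).trans hlower, hupper.trans havg_le⟩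
  have hP_zero : (0 : ℝ →ᵇ ℝ) ∈ P := fun x =>
    ⟨le_rfl, div_nonneg (hg_nonneg x) (by positivity)⟩
  have hyP : y ∈ P := hP_closed.mem_of_tendsto (hcontr.tendsto_iterate_fixedPoint 0)
    (.of_forall fun k => hP_maps.iterate k hP_zero)
  refine ⟨y, y.continuous, funext fun x => ?_, fun x => ?_⟩
  · rw [← eulerPicard_apply, hfixed]
  · simpa only [hfixed] using eulerPicard_mem_Icc hq hq_zero hq_nonneg hyP x

end SingularODE

section TanEquation

open scoped BoundedContinuousFunction

theorem seven_eighths_le_cos {y : ℝ} (hy : y ∈ Set.Icc (0 : ℝ) (1 / 2)) : 7 / 8 ≤ Real.cos y := by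
  nlinarith [Real.one_sub_sq_div_two_le_cos (x := y), hy.1, hy.2]

theorem lipschitzOnWith_tan_sub_id :
    LipschitzOnWith (1 / 2) (fun y => Real.tan y - y) (Set.Icc 0 (1 / 2)) := by
  refine (convex_Icc (0 : ℝ) (1 / 2)).lipschitzOnWith_of_nnnorm_hasDerivWithin_le
    (f' := fun y => 1 / Real.cos y ^ 2 - 1) (fun y hy => ?_) fun y hy => ?_
  · have := seven_eighths_le_cos hy
    exact ((Real.hasDerivAt_tan (by linarith)).sub (hasDerivAt_id y)).hasDerivWithinAt
  · have hcos := seven_eighths_le_cos hy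
    have hsq_le : 2 / 3 ≤ Real.cos y ^ 2 := by nlinarith
    have hle : 1 / Real.cos y ^ 2 ≤ 3 / 2 := by
      rw [div_le_iff₀ (by linarith)]
      linarith
    have hge : 1 ≤ 1 / Real.cos y ^ 2 :=
      (one_le_div (by linarith)).2 (Real.cos_sq_le_one y)
    rw [← NNReal.coe_le_coe, coe_nnnorm, Real.norm_of_nonneg (by linarith)]
    push_cast
    linarith

theorem exists_boundedContinuousFunction_eq_tan_sub_id :
    ∃ q : ℝ →ᵇ ℝ, LipschitzWith (1 / 2) q ∧ (∀ y, 0 ≤ q y) ∧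
      ∀ y ∈ Set.Icc (0 : ℝ) (1 / 2), q y = Real.tan y - y := by
  have hlip := lipschitzOnWith_tan_sub_id.to_restrict
  have hproj : LipschitzWith 1 (Set.projIcc (0 : ℝ) (1 / 2) (by norm_num)) :=
    LipschitzWith.projIcc _
  refine ⟨(BoundedContinuousFunction.mkOfCompact ⟨_, hlip.continuous⟩).compContinuous
    ⟨_, hproj.continuous⟩, ?_, fun y => ?_, fun y hy => ?_⟩
  · have hcomp := hlip.comp hproj
    rwa [mul_one] at hcomp
  · have hmem := (Set.projIcc (0 : ℝ) (1 / 2) (by norm_num) y).2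
    exact sub_nonneg.2 (Real.le_tan hmem.1 (hmem.2.trans_lt (by linarith [Real.pi_gt_three])))
  · simp [Set.projIcc_of_mem _ hy]

theorem exists_boundedContinuousFunction_eq_mul_sq {b δ : ℝ} (hb : 0 ≤ b) (hδ : b * δ ^ 2 ≤ 1) :
    ∃ g : ℝ →ᵇ ℝ, (∀ R, g R ∈ Set.Icc 0 1) ∧ (∀ R, ∀ t ∈ Set.Icc (0 : ℝ) 1, g (t * R) ≤ g R) ∧
      Set.EqOn g (fun R => b * R ^ 2) (Set.Icc 0 δ) := by
  have hmem : ∀ R : ℝ, min (b * R ^ 2) 1 ∈ Set.Icc (0 : ℝ) 1 := fun R =>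
    ⟨by positivity, min_le_right _ _⟩
  refine ⟨.ofNormedAddCommGroup (fun R => min (b * R ^ 2) 1) (by fun_prop) 1 fun R => ?_, hmem,
    fun R t ht => min_le_min_right 1 (mul_le_mul_of_nonneg_left ?_ hb),
    fun R hR => min_eq_left ?_⟩
  · rw [Real.norm_of_nonneg (hmem R).1]
    exact (hmem R).2
  · rw [mul_pow]
    exact mul_le_of_le_one_left (sq_nonneg R) (pow_le_one₀ ht.1 ht.2)
  · exact (mul_le_mul_of_nonneg_left (pow_le_pow_left₀ hR.1 hR.2 2) hb).trans hδ

theorem exists_hasDerivAt_sub_tan_div (m : ℕ) {b δ : ℝ} (hb : 0 ≤ b) (hδ : b * δ ^ 2 ≤ 1) :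
    ∃ y : ℝ → ℝ, Continuous y ∧
      (∀ R ∈ Set.Icc 0 δ, y R ∈ Set.Icc (b * R ^ 2 / (2 * (m + 3))) (b * R ^ 2 / (m + 3))) ∧
      ∀ R ∈ Set.Ioo 0 δ, HasDerivAt y ((b * R ^ 2 - (m + 1) * Real.tan (y R)) / R) R := by
  obtain ⟨q, hq_lip, hq_nonneg, hq_eq⟩ := exists_boundedContinuousFunction_eq_tan_sub_id
  obtain ⟨g, hg_mem, hg_le, hg_eq⟩ := exists_boundedContinuousFunction_eq_mul_sq hb hδ
  have havg : ∀ R ∈ Set.Icc 0 δ, eulerAverage m g R = b * R ^ 2 / (m + 3) := fun R hR => by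
    rw [eulerAverage_congr hg_eq hR, eulerAverage_const_mul, eulerAverage_pow]
    push_cast
    ring
  obtain ⟨y, hy_cont, hy_eq, hy_mem⟩ := exists_eq_eulerAverage m (by norm_num) hq_lip
    (by simp [hq_eq 0 (by norm_num)]) (fun y _ => hq_nonneg y)
    (fun R => (hg_mem R).1) hg_le
  have hy_bounds : ∀ R ∈ Set.Icc 0 δ,
      y R ∈ Set.Icc (b * R ^ 2 / (2 * (m + 3))) (b * R ^ 2 / (m + 3)) := fun R hR => by
    convert hy_mem R using 2 <;> rw [havg R hR]
    push_cast
    field_simp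
    norm_num
  refine ⟨y, hy_cont, hy_bounds, fun R hR => ?_⟩
  have hderiv := hasDerivAt_eulerAverage (m := m)
    (by fun_prop : Continuous fun s => g s - (m + 1) * q (y s)) hR.1.ne'
  rw [← hy_eq] at hderiv
  have hR' := Set.Ioo_subset_Icc_self hR
  have hy_range : y R ∈ Set.Icc (0 : ℝ) (1 / 2) := by
    obtain ⟨hlower, hupper⟩ := hy_bounds R hR'
    have hsource : b * R ^ 2 ≤ 1 := (hg_eq hR').symm.trans_le (hg_mem R).2
    refine ⟨le_trans (by positivity) hlower, hupper.trans ((div_le_iff₀ (by positivity)).2 ?_)⟩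
    linarith [m.cast_nonneg (α := ℝ)]
  refine hderiv.congr_deriv ?_
  rw [hq_eq _ hy_range, hg_eq hR']
  ring

end TanEquation

section PolarAngle

/-- The angle between the radius vector and the tangent of the curve `(R sin φ(R), R cos φ(R))` at
distance `R` from the origin, when the curve is the graph of the radial derivative of a radial
solution, in dimension `m + 1`, of `θ(D²u) = (m + 1) π / 2 - β (|x|² + |Du|²)`. Indeed
`arctan u'' = π / 2 - φ - ω` and `arctan (u' / s) = π / 2 - φ` turn this equation into
`ω = β R² - (m + 1) φ`. -/
noncomputable def tangentialAngle (m : ℕ) (β : ℝ) (φ : ℝ → ℝ) (R : ℝ) : ℝ :=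
  β * R ^ 2 - (m + 1) * φ R

/-- The curve `(R sin φ(R), R cos φ(R))`, `0 < R < δ`, is the graph of an increasing function which
is the radial derivative of a radial solution of the rotator equation: the radial equation reads
`R φ'(R) = tan ω(R)`, where `ω` is `tangentialAngle m β φ`. -/
structure IsPolarAngle (m : ℕ) (β δ : ℝ) (φ : ℝ → ℝ) : Prop where
  continuous : Continuous φ
  map_zero : φ 0 = 0
  mul_sq_le : ∀ R ∈ Set.Icc 0 δ, β / (m + 3) * R ^ 2 ≤ φ R
  tangentialAngle_pos : ∀ R ∈ Set.Ioo 0 δ, 0 < tangentialAngle m β φ R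
  add_tangentialAngle_lt : ∀ R ∈ Set.Ioo 0 δ, φ R + tangentialAngle m β φ R < Real.pi / 2
  hasDerivAt : ∀ R ∈ Set.Ioo 0 δ, HasDerivAt φ (Real.tan (tangentialAngle m β φ R) / R) R

theorem exists_isPolarAngle (m : ℕ) {β δ : ℝ} (hβ : 0 < β) (hδ₀ : 0 ≤ δ)
    (hδ : 2 * β * δ ^ 2 ≤ 1) : ∃ φ, IsPolarAngle m β δ φ := by
  obtain ⟨y, hy_cont, hy_mem, hy_deriv⟩ :=
    exists_hasDerivAt_sub_tan_div m (by positivity : 0 ≤ 2 * β) hδ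
  have htangential : tangentialAngle m β (fun R => (β * R ^ 2 - y R) / (m + 1)) = y := by
    ext R
    rw [tangentialAngle]
    field_simp
    ring
  refine ⟨fun R => (β * R ^ 2 - y R) / (m + 1), by fun_prop, ?_, fun R hR => ?_,
    fun R hR => ?_, fun R hR => ?_, fun R hR => ?_⟩
  · have hy_zero : y 0 = 0 := by simpa using hy_mem 0 ⟨le_rfl, hδ₀⟩
    simp [hy_zero]
  · calc β / (m + 3) * R ^ 2 = (β * R ^ 2 - 2 * β * R ^ 2 / (m + 3)) / (m + 1) := by
          field_simp
          ring
      _ ≤ (β * R ^ 2 - y R) / (m + 1) := by gcongr; exact (hy_mem R hR).2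
  · rw [htangential]
    have := hR.1
    exact lt_of_lt_of_le (by positivity) (hy_mem R (Set.Ioo_subset_Icc_self hR)).1
  · rw [htangential]
    have hsq : 2 * β * R ^ 2 ≤ 1 :=
      (mul_le_mul_of_nonneg_left (pow_le_pow_left₀ hR.1.le hR.2.le 2) (by positivity)).trans hδ
    have hy_le : y R ≤ 1 / (m + 1) := (hy_mem R (Set.Ioo_subset_Icc_self hR)).2.trans
      (div_le_div₀ zero_le_one hsq (by positivity) (by linarith))
    calc (β * R ^ 2 - y R) / (m + 1) + y R = (β * R ^ 2 + m * y R) / (m + 1) := by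
          field_simp
          ring
      _ ≤ ((1 : ℝ) / 2 + m * (1 / (m + 1))) / (m + 1) := by gcongr; linarith
      _ ≤ 1 := by
        field_simp
        nlinarith [m.cast_nonneg (α := ℝ)]
      _ < Real.pi / 2 := by linarith [Real.pi_gt_three]
  · rw [htangential]
    have hR0 := hR.1.ne'
    refine ((((hasDerivAt_pow 2 R).const_mul β).sub (hy_deriv R hR)).div_const _).congr_deriv ?_
    push_cast
    field_simp
    ring

variable {m : ℕ} {β δ R : ℝ} {φ : ℝ → ℝ}

namespace IsPolarAngle

theorem angle_pos (hφ : IsPolarAngle m β δ φ) (hβ : 0 < β) (hR : R ∈ Set.Ioo 0 δ) : 0 < φ R := by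
  have := hR.1
  exact lt_of_lt_of_le (by positivity) (hφ.mul_sq_le R (Set.Ioo_subset_Icc_self hR))

theorem angle_lt_pi_div_two (hφ : IsPolarAngle m β δ φ) (hR : R ∈ Set.Ioo 0 δ) :
    φ R < Real.pi / 2 := by
  linarith [hφ.tangentialAngle_pos R hR, hφ.add_tangentialAngle_lt R hR]

theorem tangentialAngle_lt_pi_div_two (hφ : IsPolarAngle m β δ φ) (hβ : 0 < β)
    (hR : R ∈ Set.Ioo 0 δ) : tangentialAngle m β φ R < Real.pi / 2 := by
  linarith [hφ.angle_pos hβ hR, hφ.add_tangentialAngle_lt R hR]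

theorem cos_tangentialAngle_pos (hφ : IsPolarAngle m β δ φ) (hβ : 0 < β) (hR : R ∈ Set.Ioo 0 δ) :
    0 < Real.cos (tangentialAngle m β φ R) :=
  Real.cos_pos_of_mem_Ioo ⟨by linarith [hφ.tangentialAngle_pos R hR, Real.pi_pos],
    hφ.tangentialAngle_lt_pi_div_two hβ hR⟩

theorem sin_add_tangentialAngle_pos (hφ : IsPolarAngle m β δ φ) (hβ : 0 < β)
    (hR : R ∈ Set.Ioo 0 δ) : 0 < Real.sin (φ R + tangentialAngle m β φ R) :=
  Real.sin_pos_of_pos_of_lt_pi (add_pos (hφ.angle_pos hβ hR) (hφ.tangentialAngle_pos R hR))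
    (by linarith [hφ.add_tangentialAngle_lt R hR, Real.pi_pos])

theorem hasDerivAt_mul_sin (hφ : IsPolarAngle m β δ φ) (hβ : 0 < β) (hR : R ∈ Set.Ioo 0 δ) :
    HasDerivAt (fun R => R * Real.sin (φ R))
      (Real.sin (φ R + tangentialAngle m β φ R) / Real.cos (tangentialAngle m β φ R)) R := by
  refine ((hasDerivAt_id' R).mul (hφ.hasDerivAt R hR).sin).congr_deriv ?_
  have hR_ne := hR.1.ne'
  have hcos := (hφ.cos_tangentialAngle_pos hβ hR).ne'
  rw [Real.sin_add, Real.tan_eq_sin_div_cos]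
  field_simp

theorem hasDerivAt_mul_cos (hφ : IsPolarAngle m β δ φ) (hβ : 0 < β) (hR : R ∈ Set.Ioo 0 δ) :
    HasDerivAt (fun R => R * Real.cos (φ R))
      (Real.cos (φ R + tangentialAngle m β φ R) / Real.cos (tangentialAngle m β φ R)) R := by
  refine ((hasDerivAt_id' R).mul (hφ.hasDerivAt R hR).cos).congr_deriv ?_
  have hR_ne := hR.1.ne'
  have hcos := (hφ.cos_tangentialAngle_pos hβ hR).ne'
  rw [Real.cos_add, Real.tan_eq_sin_div_cos]
  field_simp
  ring

theorem monotoneOn (hφ : IsPolarAngle m β δ φ) (hβ : 0 < β) : MonotoneOn φ (Set.Icc 0 δ) := by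
  refine monotoneOn_of_hasDerivWithinAt_nonneg (convex_Icc 0 δ) hφ.continuous.continuousOn
    (f' := fun R => Real.tan (tangentialAngle m β φ R) / R) ?_ ?_ <;>
    rw [interior_Icc] <;> intro R hR
  · exact (hφ.hasDerivAt R hR).hasDerivWithinAt
  · exact div_nonneg (Real.tan_pos_of_pos_of_lt_pi_div_two (hφ.tangentialAngle_pos R hR)
      (hφ.tangentialAngle_lt_pi_div_two hβ hR)).le hR.1.le

theorem strictMonoOn_mul_sin (hφ : IsPolarAngle m β δ φ) (hβ : 0 < β) :
    StrictMonoOn (fun R => R * Real.sin (φ R)) (Set.Icc 0 δ) := by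
  have hcont := hφ.continuous
  refine strictMonoOn_of_deriv_pos (convex_Icc 0 δ) (by fun_prop) fun R hR => ?_
  rw [interior_Icc] at hR
  rw [(hφ.hasDerivAt_mul_sin hβ hR).deriv]
  exact div_pos (hφ.sin_add_tangentialAngle_pos hβ hR) (hφ.cos_tangentialAngle_pos hβ hR)

end IsPolarAngle

end PolarAngle

section PolarProfile

theorem exists_continuous_monotone_rightInvOn {f : ℝ → ℝ} {a b : ℝ} (hab : a ≤ b)
    (hc : ContinuousOn f (Set.Icc a b)) (hf : StrictMonoOn f (Set.Icc a b)) :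
    ∃ J : ℝ → ℝ, Continuous J ∧ Monotone J ∧ J (f a) = a ∧
      Set.MapsTo J (Set.Ioo (f a) (f b)) (Set.Ioo a b) ∧
      Set.RightInvOn J f (Set.Ioo (f a) (f b)) := by
  have hfab : f a ≤ f b := hf.monotoneOn (Set.left_mem_Icc.2 hab) (Set.right_mem_Icc.2 hab) hab
  let e : Set.Icc a b ≃o Set.Icc (f a) (f b) := hf.orderIso.trans <|
    OrderIso.setCongr _ _ <| hc.image_Icc_of_monotoneOn hab hf.monotoneOn
  have he : ∀ x, (e x : ℝ) = f x := fun _ => rfl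
  let J : ℝ → ℝ := fun s => e.symm (Set.projIcc (f a) (f b) hfab s)
  have hJ_eq : ∀ x ∈ Set.Icc a b, J (f x) = x := fun x hx => by
    have hproj : Set.projIcc (f a) (f b) hfab (f x) = e ⟨x, hx⟩ :=
      Set.projIcc_val hfab (e ⟨x, hx⟩)
    simp only [J, hproj, e.symm_apply_apply]
  have hf_J : ∀ s ∈ Set.Icc (f a) (f b), f (J s) = s := fun s hs => by
    simp only [J, ← he, e.apply_symm_apply, Set.projIcc_of_mem hfab hs]
  have hJ_mem : ∀ s, J s ∈ Set.Icc a b := fun s => Subtype.coe_prop _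
  refine ⟨J, continuous_subtype_val.comp (e.symm.continuous.comp continuous_projIcc),
    fun s t hst => e.symm.monotone (Set.monotone_projIcc hfab hst),
    hJ_eq a (Set.left_mem_Icc.2 hab), fun s hs => ?_,
    fun s hs => hf_J s (Set.Ioo_subset_Icc_self hs)⟩
  have hs' := hf_J s (Set.Ioo_subset_Icc_self hs)
  refine ⟨(hJ_mem s).1.lt_of_ne' fun h => ?_, (hJ_mem s).2.lt_of_ne fun h => ?_⟩
  · exact hs.1.ne (h ▸ hs')
  · exact hs.2.ne' (h ▸ hs')

/-- The distance `ρ(s)` from the origin of the point with first coordinate `s` on the curve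
`(R sin φ(R), R cos φ(R))`, `0 < R < δ`. -/
structure IsPolarRadius (φ : ℝ → ℝ) (δ r : ℝ) (ρ : ℝ → ℝ) : Prop where
  continuous : Continuous ρ
  monotone : Monotone ρ
  map_zero : ρ 0 = 0
  mapsTo : Set.MapsTo ρ (Set.Ioo 0 r) (Set.Ioo 0 δ)
  mul_sin : ∀ s ∈ Set.Ioo 0 r, ρ s * Real.sin (φ (ρ s)) = s

/-- The second coordinate of the point with first coordinate `s` on the curve
`(R sin φ(R), R cos φ(R))`, if `ρ` is the polar radius of that curve. -/
noncomputable def polarProfile (φ ρ : ℝ → ℝ) (s : ℝ) : ℝ :=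
  ρ s * Real.cos (φ (ρ s))

variable {m : ℕ} {β δ r s : ℝ} {φ ρ : ℝ → ℝ}

theorem IsPolarAngle.exists_isPolarRadius (hφ : IsPolarAngle m β δ φ) (hβ : 0 < β) (hδ : 0 < δ) :
    ∃ r, 0 < r ∧ ∃ ρ, IsPolarRadius φ δ r ρ := by
  have hcont := hφ.continuous
  have hmono := hφ.strictMonoOn_mul_sin hβ
  obtain ⟨ρ, hρ_cont, hρ_mono, hρ_zero, hρ_maps, hρ_inv⟩ :=
    exists_continuous_monotone_rightInvOn hδ.le (by fun_prop) hmono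
  have hlt := hmono (Set.left_mem_Icc.2 hδ.le) (Set.right_mem_Icc.2 hδ.le) hδ
  simp only [zero_mul] at hρ_zero hρ_maps hρ_inv hlt
  exact ⟨_, hlt, ρ, hρ_cont, hρ_mono, hρ_zero, hρ_maps, hρ_inv⟩

namespace IsPolarRadius

theorem continuous_polarProfile (hρ : IsPolarRadius φ δ r ρ) (hφ : Continuous φ) :
    Continuous (polarProfile φ ρ) :=
  hρ.continuous.mul (Real.continuous_cos.comp (hφ.comp hρ.continuous))

theorem polarProfile_zero (hρ : IsPolarRadius φ δ r ρ) : polarProfile φ ρ 0 = 0 := by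
  rw [polarProfile, hρ.map_zero, zero_mul]

theorem sq_add_polarProfile_sq (hρ : IsPolarRadius φ δ r ρ) (hs : s ∈ Set.Ioo 0 r) :
    s ^ 2 + polarProfile φ ρ s ^ 2 = ρ s ^ 2 := by
  calc s ^ 2 + polarProfile φ ρ s ^ 2
      = ρ s ^ 2 * (Real.sin (φ (ρ s)) ^ 2 + Real.cos (φ (ρ s)) ^ 2) := by
        nth_rw 1 [← hρ.mul_sin s hs]
        rw [polarProfile]
        ring
    _ = ρ s ^ 2 := by rw [Real.sin_sq_add_cos_sq, mul_one]

theorem polarProfile_div (hρ : IsPolarRadius φ δ r ρ) (hs : s ∈ Set.Ioo 0 r) :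
    polarProfile φ ρ s / s = Real.tan (Real.pi / 2 - φ (ρ s)) := by
  nth_rw 2 [← hρ.mul_sin s hs]
  rw [polarProfile, mul_div_mul_left _ _ (hρ.mapsTo hs).1.ne', Real.tan_eq_sin_div_cos,
    Real.sin_pi_div_two_sub, Real.cos_pi_div_two_sub]

theorem hasDerivAt_radius (hρ : IsPolarRadius φ δ r ρ) (hφ : IsPolarAngle m β δ φ) (hβ : 0 < β)
    (hs : s ∈ Set.Ioo 0 r) :
    HasDerivAt ρ (Real.sin (φ (ρ s) + tangentialAngle m β φ (ρ s)) /
      Real.cos (tangentialAngle m β φ (ρ s)))⁻¹ s := by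
  have hmem := hρ.mapsTo hs
  refine HasDerivAt.of_local_left_inverse hρ.continuous.continuousAt
    (hφ.hasDerivAt_mul_sin hβ hmem)
    (div_pos (hφ.sin_add_tangentialAngle_pos hβ hmem) (hφ.cos_tangentialAngle_pos hβ hmem)).ne' ?_
  filter_upwards [isOpen_Ioo.mem_nhds hs] with t ht using hρ.mul_sin t ht

theorem hasDerivAt_polarProfile (hρ : IsPolarRadius φ δ r ρ) (hφ : IsPolarAngle m β δ φ)
    (hβ : 0 < β) (hs : s ∈ Set.Ioo 0 r) :
    HasDerivAt (polarProfile φ ρ)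
      (Real.tan (Real.pi / 2 - (φ (ρ s) + tangentialAngle m β φ (ρ s)))) s := by
  have hmem := hρ.mapsTo hs
  have hcos := (hφ.cos_tangentialAngle_pos hβ hmem).ne'
  refine ((hφ.hasDerivAt_mul_cos hβ hmem).comp s (hρ.hasDerivAt_radius hφ hβ hs)).congr_deriv ?_
  rw [Real.tan_eq_sin_div_cos, Real.sin_pi_div_two_sub, Real.cos_pi_div_two_sub]
  field_simp

theorem deriv_polarProfile_pos (hρ : IsPolarRadius φ δ r ρ) (hφ : IsPolarAngle m β δ φ)
    (hβ : 0 < β) (hs : s ∈ Set.Ioo 0 r) : 0 < deriv (polarProfile φ ρ) s := by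
  have hmem := hρ.mapsTo hs
  rw [(hρ.hasDerivAt_polarProfile hφ hβ hs).deriv]
  apply Real.tan_pos_of_pos_of_lt_pi_div_two <;>
    linarith [hφ.angle_pos hβ hmem, hφ.tangentialAngle_pos _ hmem,
      hφ.add_tangentialAngle_lt _ hmem]

theorem arctan_deriv_polarProfile (hρ : IsPolarRadius φ δ r ρ) (hφ : IsPolarAngle m β δ φ)
    (hβ : 0 < β) (hs : s ∈ Set.Ioo 0 r) :
    Real.arctan (deriv (polarProfile φ ρ) s) + m * Real.arctan (polarProfile φ ρ s / s) =
      (m + 1) * (Real.pi / 2) - β * (s ^ 2 + polarProfile φ ρ s ^ 2) := by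
  have hmem := hρ.mapsTo hs
  have hφ_pos := hφ.angle_pos hβ hmem
  have htan_pos := hφ.tangentialAngle_pos _ hmem
  have hadd := hφ.add_tangentialAngle_lt _ hmem
  rw [(hρ.hasDerivAt_polarProfile hφ hβ hs).deriv, hρ.polarProfile_div hs,
    hρ.sq_add_polarProfile_sq hs, Real.arctan_tan (by linarith) (by linarith),
    Real.arctan_tan (by linarith) (by linarith), tangentialAngle]
  ring

theorem antitoneOn_polarProfile_div (hρ : IsPolarRadius φ δ r ρ) (hφ : IsPolarAngle m β δ φ)
    (hβ : 0 < β) : AntitoneOn (fun s => polarProfile φ ρ s / s) (Set.Ioo 0 r) := by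
  intro s hs t ht hst
  have hangle : φ (ρ s) ≤ φ (ρ t) := hφ.monotoneOn hβ
    (Set.Ioo_subset_Icc_self (hρ.mapsTo hs)) (Set.Ioo_subset_Icc_self (hρ.mapsTo ht))
    (hρ.monotone hst)
  have hφs_pos := hφ.angle_pos hβ (hρ.mapsTo hs)
  have hφt_lt := hφ.angle_lt_pi_div_two (hρ.mapsTo ht)
  simp only [hρ.polarProfile_div hs, hρ.polarProfile_div ht]
  refine Real.strictMonoOn_tan.monotoneOn ⟨?_, ?_⟩ ⟨?_, ?_⟩ ?_ <;> linarith

theorem tendsto_polarProfile_div (hρ : IsPolarRadius φ δ r ρ) (hφ : IsPolarAngle m β δ φ)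
    (hβ : 0 < β) (hr : 0 < r) :
    Filter.Tendsto (fun s => polarProfile φ ρ s / s) (𝓝[>] 0) Filter.atTop := by
  have hangle : Filter.Tendsto (fun s => Real.pi / 2 - φ (ρ s)) (𝓝[>] 0)
      (𝓝[<] (Real.pi / 2)) := by
    refine tendsto_nhdsWithin_iff.2 ⟨?_, ?_⟩
    · have hcont : Continuous fun s => Real.pi / 2 - φ (ρ s) :=
        continuous_const.sub (hφ.continuous.comp hρ.continuous)
      simpa [hρ.map_zero, hφ.map_zero] using (hcont.tendsto 0).mono_left nhdsWithin_le_nhds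
    · filter_upwards [Ioo_mem_nhdsGT hr] with s hs
      exact sub_lt_self _ (hφ.angle_pos hβ (hρ.mapsTo hs))
  refine (Real.tendsto_tan_pi_div_two.comp hangle).congr' ?_
  filter_upwards [Ioo_mem_nhdsGT hr] with s hs using (hρ.polarProfile_div hs).symm

theorem mul_radius_pow_three_le (hρ : IsPolarRadius φ δ r ρ) (hφ : IsPolarAngle m β δ φ)
    (hβ : 0 < β) (hs : s ∈ Set.Ioo 0 r) : 2 / Real.pi * (β / (m + 3)) * ρ s ^ 3 ≤ s := by
  have hmem := hρ.mapsTo hs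
  have hjordan : 2 / Real.pi * φ (ρ s) ≤ Real.sin (φ (ρ s)) :=
    Real.mul_le_sin (hφ.angle_pos hβ hmem).le (hφ.angle_lt_pi_div_two hmem).le
  have hmul := hφ.mul_sq_le _ (Set.Ioo_subset_Icc_self hmem)
  have hρ_nonneg := hmem.1.le
  calc 2 / Real.pi * (β / (m + 3)) * ρ s ^ 3
      = ρ s * (2 / Real.pi * (β / (m + 3) * ρ s ^ 2)) := by ring
    _ ≤ ρ s * Real.sin (φ (ρ s)) := by grw [hmul, hjordan]
    _ = s := hρ.mul_sin s hs

theorem exists_polarProfile_le_rpow (hρ : IsPolarRadius φ δ r ρ) (hφ : IsPolarAngle m β δ φ)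
    (hβ : 0 < β) :
    ∃ C : ℝ≥0, ∀ s ∈ Set.Ioo 0 r, polarProfile φ ρ s ≤ C * s ^ (1 / 3 : ℝ) := by
  let κ := 2 / Real.pi * (β / (m + 3))
  have hκ : 0 < κ := by positivity
  refine ⟨⟨κ⁻¹ ^ (1 / 3 : ℝ), by positivity⟩, fun s hs => ?_⟩
  have hρ_nonneg := (hρ.mapsTo hs).1.le
  calc polarProfile φ ρ s ≤ ρ s := mul_le_of_le_one_right hρ_nonneg (Real.cos_le_one _)
    _ = (ρ s ^ 3) ^ (1 / 3 : ℝ) := by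
      rw [← Real.rpow_natCast, ← Real.rpow_mul hρ_nonneg]
      norm_num
    _ ≤ (κ⁻¹ * s) ^ (1 / 3 : ℝ) := by
      gcongr
      exact (le_inv_mul_iff₀ hκ).2 (hρ.mul_radius_pow_three_le hφ hβ hs)
    _ = κ⁻¹ ^ (1 / 3 : ℝ) * s ^ (1 / 3 : ℝ) := Real.mul_rpow (by positivity) hs.1.le

end IsPolarRadius

/-- `h` is the radial derivative of a convex radial function `u` in dimension `m + 1`, smooth away
from the origin and singular there, with `θ(D²u) = (m + 1) π / 2 - β (|x|² + |Du|²)`: the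
eigenvalues of `D²u` are `h'` once and `h / |x|` with multiplicity `m`. -/
structure IsSingularProfile (m : ℕ) (β r : ℝ) (h : ℝ → ℝ) : Prop where
  continuous : Continuous h
  map_zero : h 0 = 0
  deriv_pos : ∀ s ∈ Set.Ioo 0 r, 0 < deriv h s
  arctan_deriv : ∀ s ∈ Set.Ioo 0 r, Real.arctan (deriv h s) + m * Real.arctan (h s / s) =
    (m + 1) * (Real.pi / 2) - β * (s ^ 2 + h s ^ 2)
  antitoneOn_div : AntitoneOn (fun s => h s / s) (Set.Ioo 0 r)
  tendsto_div : Filter.Tendsto (fun s => h s / s) (𝓝[>] 0) Filter.atTop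
  exists_le_rpow : ∃ C : ℝ≥0, ∀ s ∈ Set.Ioo 0 r, h s ≤ C * s ^ (1 / 3 : ℝ)

theorem exists_isSingularProfile (m : ℕ) (hβ : 0 < β) :
    ∃ r, 0 < r ∧ ∃ h, IsSingularProfile m β r h := by
  have hδ : 0 < √(1 / (2 * β)) := by positivity
  obtain ⟨φ, hφ⟩ := exists_isPolarAngle m hβ hδ.le <| by
    rw [Real.sq_sqrt (by positivity), mul_one_div_cancel (by positivity)]
  obtain ⟨r, hr, ρ, hρ⟩ := hφ.exists_isPolarRadius hβ hδ
  exact ⟨r, hr, polarProfile φ ρ,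
    { continuous := hρ.continuous_polarProfile hφ.continuous
      map_zero := hρ.polarProfile_zero
      deriv_pos := fun s hs => hρ.deriv_polarProfile_pos hφ hβ hs
      arctan_deriv := fun s hs => hρ.arctan_deriv_polarProfile hφ hβ hs
      antitoneOn_div := hρ.antitoneOn_polarProfile_div hφ hβ
      tendsto_div := hρ.tendsto_polarProfile_div hφ hβ hr
      exists_le_rpow := hρ.exists_polarProfile_le_rpow hφ hβ }⟩

end PolarProfile

section SingularProfile

theorem contDiffOn_infty_of_hasDerivAt {f F : ℝ → ℝ} {s : Set ℝ} (hs : IsOpen s)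
    (hf : ∀ x ∈ s, HasDerivAt f (F x) x)
    (hF : ∀ k : ℕ, ContDiffOn ℝ k f s → ContDiffOn ℝ k F s) : ContDiffOn ℝ ∞ f s := by
  refine contDiffOn_infty.2 fun k => ?_
  induction k with
  | zero => exact contDiffOn_zero.2 fun x hx => (hf x hx).continuousAt.continuousWithinAt
  | succ k ih =>
    rw [Nat.cast_succ, contDiffOn_succ_iff_deriv_of_isOpen hs]
    exact ⟨fun x hx => (hf x hx).differentiableAt.differentiableWithinAt, by simp,
      (hF k ih).congr fun x hx => (hf x hx).deriv⟩

namespace IsSingularProfile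

variable {m : ℕ} {β r s : ℝ} {h : ℝ → ℝ}

theorem hasDerivAt (hh : IsSingularProfile m β r h) (hs : s ∈ Set.Ioo 0 r) :
    HasDerivAt h (deriv h s) s :=
  (differentiableAt_of_deriv_ne_zero (hh.deriv_pos s hs).ne').hasDerivAt

theorem strictMonoOn (hh : IsSingularProfile m β r h) : StrictMonoOn h (Set.Ico 0 r) := by
  refine strictMonoOn_of_deriv_pos (convex_Ico 0 r) hh.continuous.continuousOn ?_
  rw [interior_Ico]
  exact hh.deriv_pos

theorem contDiffOn (hh : IsSingularProfile m β r h) : ContDiffOn ℝ ∞ h (Set.Ioo 0 r) := by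
  let ψ : ℝ → ℝ := fun s =>
    (m + 1) * (Real.pi / 2) - β * (s ^ 2 + h s ^ 2) - m * Real.arctan (h s / s)
  have hψ : ∀ s ∈ Set.Ioo 0 r, ψ s = Real.arctan (deriv h s) := fun s hs =>
    (eq_sub_of_add_eq (hh.arctan_deriv s hs)).symm
  refine contDiffOn_infty_of_hasDerivAt (F := fun s => Real.tan (ψ s)) isOpen_Ioo
    (fun s hs => ?_) fun k hk => ?_
  · rw [hψ s hs, Real.tan_arctan]
    exact hh.hasDerivAt hs
  · have hψ_smooth : ContDiffOn ℝ k ψ (Set.Ioo 0 r) :=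
      (contDiffOn_const.sub (contDiffOn_const.mul ((contDiffOn_id.pow 2).add (hk.pow 2)))).sub
        (contDiffOn_const.mul (hk.div contDiffOn_id fun s hs => hs.1.ne').arctan)
    intro s hs
    have hcos : Real.cos (ψ s) ≠ 0 := by
      rw [hψ s hs]
      exact (Real.cos_arctan_pos _).ne'
    exact (Real.contDiffAt_tan.2 hcos).comp_contDiffWithinAt s (hψ_smooth s hs)

end IsSingularProfile

end SingularProfile

section Radial

/-- The radial function `U(|x|)` with `U' = h` and `U(0) = 0`. -/
noncomputable def radialPotential {E : Type*} [Norm E] (h : ℝ → ℝ) (x : E) : ℝ :=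
  ∫ t in (0 : ℝ)..‖x‖, h t

/-- The radial vector field `h(|x|) x / |x|`; its value at the origin is `0`. -/
noncomputable def radialField {E : Type*} [NormedAddCommGroup E] [NormedSpace ℝ E] (h : ℝ → ℝ)
    (x : E) : E :=
  (h ‖x‖ / ‖x‖) • x

variable {h : ℝ → ℝ} {r : ℝ}

section NormedSpace

variable {E : Type*} [NormedAddCommGroup E]

theorem eventually_mul_norm_sq_le_radialPotential (hc : Continuous h) (h0 : h 0 = 0)
    (ht : Filter.Tendsto (fun s => h s / s) (𝓝[>] 0) Filter.atTop) (M : ℝ) :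
    ∀ᶠ x : E in 𝓝 0, M / 2 * ‖x‖ ^ 2 ≤ radialPotential h x := by
  obtain ⟨ρ, hρ, hρM⟩ := mem_nhdsGT_iff_exists_Ioo_subset.1 (ht.eventually_ge_atTop M)
  filter_upwards [Metric.ball_mem_nhds (0 : E) hρ] with x hx
  rw [mem_ball_zero_iff] at hx
  calc M / 2 * ‖x‖ ^ 2 = ∫ t in (0 : ℝ)..‖x‖, M * t := by
        rw [intervalIntegral.integral_const_mul, integral_id]
        ring
    _ ≤ radialPotential h x := by
      refine intervalIntegral.integral_mono_on (norm_nonneg x)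
        (Continuous.intervalIntegrable (by fun_prop) _ _) (hc.intervalIntegrable _ _) fun t ht => ?_
      rcases ht.1.eq_or_lt with rfl | ht0
      · simp [h0]
      · exact (le_div_iff₀ ht0).1 (hρM ⟨ht0, ht.2.trans_lt hx⟩)

variable [NormedSpace ℝ E]

theorem convexOn_radialPotential (hc : Continuous h) (h0 : h 0 = 0)
    (hm : MonotoneOn h (Set.Ico 0 r)) :
    ConvexOn ℝ (Metric.ball (0 : E) r) (radialPotential h) := by
  let U : ℝ → ℝ := fun s => ∫ t in (0 : ℝ)..s, h t
  have hU : ∀ s, HasDerivAt U (h s) s := fun s => (hc.integral_hasStrictDerivAt 0 s).hasDerivAt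
  have hU_diff : Differentiable ℝ U := fun s => (hU s).differentiableAt
  have hU_deriv : deriv U = h := funext fun s => (hU s).deriv
  have hU_convex : ConvexOn ℝ (Set.Ico 0 r) U := by
    refine MonotoneOn.convexOn_of_deriv (convex_Ico 0 r) hU_diff.continuous.continuousOn
      hU_diff.differentiableOn ?_
    rw [hU_deriv]
    exact hm.mono interior_subset
  have hU_mono : MonotoneOn U (Set.Ico 0 r) := by
    refine monotoneOn_of_deriv_nonneg (convex_Ico 0 r) hU_diff.continuous.continuousOn
      hU_diff.differentiableOn fun s hs => ?_
    have hs' := interior_subset hs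
    rw [hU_deriv, ← h0]
    exact hm ⟨le_rfl, hs'.1.trans_lt hs'.2⟩ hs' hs'.1
  have himage : norm '' Metric.ball (0 : E) r ⊆ Set.Ico 0 r := by
    rintro _ ⟨x, hx, rfl⟩
    exact ⟨norm_nonneg x, mem_ball_zero_iff.1 hx⟩
  have hconvex_image : Convex ℝ (norm '' Metric.ball (0 : E) r) :=
    ((convex_ball 0 r).isPreconnected.image _ continuous_norm.continuousOn).ordConnected.convex
  exact (hU_convex.subset himage hconvex_image).comp (convexOn_norm (convex_ball 0 r))
    (hU_mono.mono himage)

theorem norm_radialField (h0 : h 0 = 0) (x : E) : ‖radialField h x‖ = |h ‖x‖| := by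
  rcases eq_or_ne x 0 with rfl | hx
  · simp [radialField, h0]
  · rw [radialField, norm_smul, norm_div, norm_norm, div_mul_cancel₀ _ (norm_ne_zero_iff.2 hx),
      Real.norm_eq_abs]

theorem norm_radialField_sub_le (h0 : h 0 = 0) (hm : MonotoneOn h (Set.Ico 0 r))
    (ha : AntitoneOn (fun s => h s / s) (Set.Ioo 0 r)) {x y : E} (hx : ‖x‖ < r)
    (hxy : ‖y‖ ≤ ‖x‖) :
    ‖radialField h x - radialField h y‖ ≤ 2 * (h ‖x‖ / ‖x‖ * ‖x - y‖) := by
  rcases eq_or_ne x 0 with rfl | hx_ne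
  · simp [norm_le_zero_iff.1 (norm_zero (E := E) ▸ hxy)]
  have hx_pos := norm_pos_iff.2 hx_ne
  have hslope_nonneg : 0 ≤ h ‖x‖ / ‖x‖ :=
    div_nonneg (h0 ▸ hm ⟨le_rfl, hx_pos.trans hx⟩ ⟨hx_pos.le, hx⟩ hx_pos.le) hx_pos.le
  have hslope_diff : ‖(h ‖x‖ / ‖x‖ - h ‖y‖ / ‖y‖) • y‖ ≤ h ‖x‖ / ‖x‖ * ‖x - y‖ := by
    rcases eq_or_ne y 0 with rfl | hy_ne
    · simpa using mul_nonneg hslope_nonneg hx_pos.le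
    have hy_pos := norm_pos_iff.2 hy_ne
    have hanti : h ‖x‖ / ‖x‖ ≤ h ‖y‖ / ‖y‖ := ha ⟨hy_pos, hxy.trans_lt hx⟩ ⟨hx_pos, hx⟩ hxy
    calc ‖(h ‖x‖ / ‖x‖ - h ‖y‖ / ‖y‖) • y‖ = h ‖y‖ - h ‖x‖ / ‖x‖ * ‖y‖ := by
          rw [norm_smul, Real.norm_eq_abs, abs_sub_comm, abs_of_nonneg (sub_nonneg.2 hanti),
            sub_mul, div_mul_cancel₀ _ hy_pos.ne']
      _ ≤ h ‖x‖ - h ‖x‖ / ‖x‖ * ‖y‖ := by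
          gcongr
          exact hm ⟨hy_pos.le, hxy.trans_lt hx⟩ ⟨hx_pos.le, hx⟩ hxy
      _ = h ‖x‖ / ‖x‖ * (‖x‖ - ‖y‖) := by rw [mul_sub, div_mul_cancel₀ _ hx_pos.ne']
      _ ≤ h ‖x‖ / ‖x‖ * ‖x - y‖ := by
          gcongr
          exact norm_sub_norm_le x y
  calc ‖radialField h x - radialField h y‖
      = ‖(h ‖x‖ / ‖x‖) • (x - y) + (h ‖x‖ / ‖x‖ - h ‖y‖ / ‖y‖) • y‖ := by
        simp only [radialField]
        congr 1
        module
    _ ≤ h ‖x‖ / ‖x‖ * ‖x - y‖ + h ‖x‖ / ‖x‖ * ‖x - y‖ := by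
        refine norm_add_le_of_le ?_ hslope_diff
        rw [norm_smul, Real.norm_of_nonneg hslope_nonneg]
    _ = 2 * (h ‖x‖ / ‖x‖ * ‖x - y‖) := (two_mul _).symm

theorem div_mul_le_of_le_mul_rpow {A C s d α : ℝ} (hα₀ : 0 ≤ α) (hα₁ : α ≤ 1) (hC : 0 ≤ C)
    (hs : 0 < s) (hd₀ : 0 ≤ d) (hd : d ≤ 2 * s) (hA : A ≤ C * s ^ α) :
    A / s * d ≤ 2 * C * d ^ α :=
  calc A / s * d = 2 * (A * (d / (2 * s))) := by field_simp
    _ ≤ 2 * (C * s ^ α * (d / (2 * s)) ^ α) := by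
        gcongr
        exact Real.self_le_rpow_of_le_one (by positivity)
          ((div_le_one (by positivity)).2 hd) hα₁
    _ = 2 * C * (d / 2) ^ α := by
        rw [mul_assoc C, ← Real.mul_rpow hs.le (by positivity), ← mul_assoc]
        congr 2
        field_simp
    _ ≤ 2 * C * d ^ α := by
        gcongr
        linarith

theorem holderOnWith_of_dist_le {X Y : Type*} [PseudoMetricSpace X] [PseudoMetricSpace Y]
    {f : X → Y} {s : Set X} {C α : ℝ≥0}
    (hf : ∀ x ∈ s, ∀ y ∈ s, dist (f x) (f y) ≤ C * dist x y ^ (α : ℝ)) :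
    HolderOnWith C α f s := by
  intro x hx y hy
  rw [edist_dist, edist_dist, ENNReal.ofReal_rpow_of_nonneg dist_nonneg α.coe_nonneg,
    ← ENNReal.ofReal_coe_nnreal, ← ENNReal.ofReal_mul C.coe_nonneg]
  exact ENNReal.ofReal_le_ofReal (hf x hx y hy)

theorem holderOnWith_radialField {C α : ℝ≥0} (hα : α ≤ 1) (h0 : h 0 = 0)
    (hm : MonotoneOn h (Set.Ico 0 r)) (ha : AntitoneOn (fun s => h s / s) (Set.Ioo 0 r))
    (hC : ∀ s ∈ Set.Ioo 0 r, h s ≤ C * s ^ (α : ℝ)) :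
    HolderOnWith (4 * C) α (radialField h) (Metric.ball (0 : E) r) := by
  refine holderOnWith_of_dist_le fun x hx y hy => ?_
  wlog hxy : ‖y‖ ≤ ‖x‖ generalizing x y
  · rw [dist_comm, dist_comm x]
    exact this y hy x hx (le_of_not_ge hxy)
  rw [mem_ball_zero_iff] at hx
  rw [dist_eq_norm, dist_eq_norm]
  refine (norm_radialField_sub_le h0 hm ha hx hxy).trans ?_
  rcases eq_or_ne x 0 with rfl | hx_ne
  · simp only [norm_zero, div_zero, zero_mul, mul_zero]
    positivity
  have hx_pos := norm_pos_iff.2 hx_ne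
  have hdist : ‖x - y‖ ≤ 2 * ‖x‖ := by linarith [norm_sub_le x y]
  calc 2 * (h ‖x‖ / ‖x‖ * ‖x - y‖) ≤ 2 * (2 * C * ‖x - y‖ ^ (α : ℝ)) := by
        refine mul_le_mul_of_nonneg_left ?_ zero_le_two
        exact div_mul_le_of_le_mul_rpow α.coe_nonneg hα C.coe_nonneg hx_pos (norm_nonneg _) hdist
          (hC _ ⟨hx_pos, hx⟩)
    _ = ↑(4 * C) * ‖x - y‖ ^ (α : ℝ) := by
        push_cast
        ring

theorem not_differentiableAt_radialField [Nontrivial E]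
    (ht : Filter.Tendsto (fun s => h s / s) (𝓝[>] 0) Filter.atTop) :
    ¬ DifferentiableAt ℝ (radialField h : E → E) 0 := by
  intro hdiff
  obtain ⟨C, hC⟩ := hdiff.hasFDerivAt.isBigO_sub.bound
  obtain ⟨e, he⟩ := exists_norm_eq E zero_le_one
  have hray : Filter.Tendsto (fun s : ℝ => s • e) (𝓝[>] 0) (𝓝 0) := by
    have hcont : Continuous fun s : ℝ => s • e := by fun_prop
    simpa using (hcont.tendsto 0).mono_left nhdsWithin_le_nhds
  obtain ⟨s, ⟨hbound, hlarge⟩, hs⟩ := ((hray.eventually hC).and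
    (ht.eventually_gt_atTop (max C 0))).and self_mem_nhdsWithin |>.exists
  replace hs : 0 < s := hs
  have hslope : 0 ≤ h s / s := (le_max_right _ _).trans hlarge.le
  simp only [radialField, norm_smul, he, Real.norm_of_nonneg hs.le, mul_one, smul_zero, sub_zero,
    Real.norm_of_nonneg hslope] at hbound
  exact ((le_max_left C 0).trans_lt hlarge).not_ge (le_of_mul_le_mul_right hbound hs)

end NormedSpace

section InnerProductSpace

variable {E : Type*} [NormedAddCommGroup E] [InnerProductSpace ℝ E] {x : E}

theorem hasFDerivAt_comp_norm {g : ℝ → ℝ} {g' : ℝ} (hx : x ≠ 0) (hg : HasDerivAt g g' ‖x‖) :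
    HasFDerivAt (fun y : E => g ‖y‖) ((g' / ‖x‖) • innerSL ℝ x) x := by
  have hx_ne : ‖x‖ ≠ 0 := norm_ne_zero_iff.2 hx
  have hnorm : HasFDerivAt (fun y : E => ‖y‖) (‖x‖⁻¹ • innerSL ℝ x) x := by
    have hsqrt := (hasStrictFDerivAt_norm_sq x).hasFDerivAt.sqrt (pow_ne_zero 2 hx_ne)
    simp only [Real.sqrt_sq (norm_nonneg _)] at hsqrt
    refine hsqrt.congr_fderiv ?_
    rw [two_nsmul, ← two_smul ℝ, smul_smul]
    congr 1
    field_simp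
  refine (hg.comp_hasFDerivAt x hnorm).congr_fderiv ?_
  rw [smul_smul, div_eq_mul_inv]

theorem hasFDerivAt_radialPotential (hc : Continuous h) (h0 : h 0 = 0) (x : E) :
    HasFDerivAt (radialPotential h) ((h ‖x‖ / ‖x‖) • innerSL ℝ x) x := by
  have hU : ∀ s, HasDerivAt (fun s => ∫ t in (0 : ℝ)..s, h t) (h s) s := fun s =>
    (hc.integral_hasStrictDerivAt 0 s).hasDerivAt
  rcases eq_or_ne x 0 with rfl | hx
  · have hU_zero := hU 0
    rw [h0, hasDerivAt_iff_isLittleO_nhds_zero] at hU_zero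
    rw [norm_zero, h0, zero_div, zero_smul, hasFDerivAt_iff_isLittleO_nhds_zero,
      ← Asymptotics.isLittleO_norm_right]
    simpa [radialPotential, Function.comp_def] using
      hU_zero.comp_tendsto (tendsto_norm_zero (E := E))
  · exact hasFDerivAt_comp_norm hx (hU ‖x‖)

theorem gradient_radialPotential [CompleteSpace E] (hc : Continuous h) (h0 : h 0 = 0) :
    gradient (radialPotential h : E → ℝ) = radialField h := by
  ext1 x
  refine HasGradientAt.gradient (hasGradientAt_iff_hasFDerivAt.2 ?_)
  refine (hasFDerivAt_radialPotential hc h0 x).congr_fderiv ?_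
  ext v
  simp [radialField]

theorem contDiffOn_radialPotential (hc : Continuous h) (hs : ContDiffOn ℝ ∞ h (Set.Ioo 0 r)) :
    ContDiffOn ℝ ∞ (radialPotential h) (Metric.ball (0 : E) r \ {0}) := by
  have hU : ContDiffOn ℝ ∞ (fun s => ∫ t in (0 : ℝ)..s, h t) (Set.Ioo 0 r) :=
    contDiffOn_infty_of_hasDerivAt isOpen_Ioo
      (fun s _ => (hc.integral_hasStrictDerivAt 0 s).hasDerivAt)
      fun _ _ => hs.of_le (by exact_mod_cast le_top)
  exact hU.comp (fun x hx => (contDiffAt_norm ℝ hx.2).contDiffWithinAt) fun x hx =>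
    ⟨norm_pos_iff.2 hx.2, mem_ball_zero_iff.1 hx.1⟩

theorem fderiv_fderiv_radialPotential {h' : ℝ} (hc : Continuous h) (h0 : h 0 = 0) (hx : x ≠ 0)
    (hd : HasDerivAt h h' ‖x‖) (v w : E) :
    fderiv ℝ (fderiv ℝ (radialPotential h)) x v w =
      h ‖x‖ / ‖x‖ * inner ℝ v w +
        (h' - h ‖x‖ / ‖x‖) / ‖x‖ ^ 2 * (inner ℝ x v * inner ℝ x w) := by
  have hx_ne : ‖x‖ ≠ 0 := norm_ne_zero_iff.2 hx
  have hfderiv : fderiv ℝ (radialPotential h : E → ℝ) = fun y => (h ‖y‖ / ‖y‖) • innerSL ℝ y :=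
    funext fun y => (hasFDerivAt_radialPotential hc h0 y).fderiv
  have hslope : HasFDerivAt (fun y : E => h ‖y‖ / ‖y‖) _ x :=
    hasFDerivAt_comp_norm hx (hd.div (hasDerivAt_id' _) hx_ne)
  rw [hfderiv, (hslope.fun_smul (innerSL ℝ (E := E)).hasFDerivAt).fderiv]
  simp only [add_apply, smul_apply, ContinuousLinearMap.smulRight_apply, smul_eq_mul,
    @innerSL_apply_apply ℝ]
  field_simp

theorem fderiv_fderiv_const_mul_norm_sq (M : ℝ) (x v w : E) :
    fderiv ℝ (fderiv ℝ fun y : E => M / 2 * ‖y‖ ^ 2) x v w = M * inner ℝ v w := by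
  have hfderiv : (fderiv ℝ fun y : E => M / 2 * ‖y‖ ^ 2) = ⇑(M • innerSL ℝ (E := E)) := by
    ext1 y
    refine ((hasStrictFDerivAt_norm_sq y).hasFDerivAt.const_mul (M / 2)).fderiv.trans ?_
    rw [two_nsmul, ← two_smul ℝ, smul_smul, div_mul_cancel₀ _ two_ne_zero]
    rfl
  rw [hfderiv, ContinuousLinearMap.fderiv]
  rfl

theorem not_eventually_radialPotential_le [Nontrivial E] (hc : Continuous h) (h0 : h 0 = 0)
    (ht : Filter.Tendsto (fun s => h s / s) (𝓝[>] 0) Filter.atTop) {φ : E → ℝ}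
    (hφ : ContDiffAt ℝ 2 φ 0) (hφ0 : φ 0 = radialPotential h (0 : E)) :
    ¬ ∀ᶠ x in 𝓝 0, radialPotential h x ≤ φ x := by
  intro hle
  obtain ⟨e, he⟩ := exists_norm_eq E zero_le_one
  let M := fderiv ℝ (fderiv ℝ φ) 0 e e + 1
  have hparabola : ∀ᶠ x : E in 𝓝 0, M / 2 * ‖x‖ ^ 2 ≤ φ x := by
    filter_upwards [hle, eventually_mul_norm_sq_le_radialPotential hc h0 ht M] with x hx hMx
      using hMx.trans hx
  have hM : M ≤ fderiv ℝ (fderiv ℝ φ) 0 e e := by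
    simpa [fderiv_fderiv_const_mul_norm_sq, he] using fderiv_fderiv_le_of_eventually_le
      (contDiff_const.mul (contDiff_norm_sq ℝ)).contDiffAt hφ
      (by simp [hφ0, radialPotential]) hparabola e
  exact (lt_add_one _).not_ge hM

end InnerProductSpace

theorem lagrangianAngle_hessianMatrix_radialPotential {m : ℕ} {h' : ℝ} (hc : Continuous h)
    (h0 : h 0 = 0) {x : EuclideanSpace ℝ (Fin (m + 1))} (hx : x ≠ 0)
    (hd : HasDerivAt h h' ‖x‖) :
    lagrangianAngle (hessianMatrix (radialPotential h) x) =
      Real.arctan h' + m * Real.arctan (h ‖x‖ / ‖x‖) := by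
  have hhessian : hessianMatrix (radialPotential h) x =
      Matrix.scalar (Fin (m + 1)) (h ‖x‖ / ‖x‖) +
        Matrix.vecMulVec (((h' - h ‖x‖ / ‖x‖) / ‖x‖ ^ 2) • x.ofLp) x.ofLp := by
    ext i j
    rw [hessianMatrix, Matrix.of_apply, fderiv_fderiv_radialPotential hc h0 hx hd]
    simp [Matrix.vecMulVec_apply, Matrix.diagonal_apply, EuclideanSpace.inner_single_right,
      @eq_comm _ j i]
  have hdot : x.ofLp ⬝ᵥ x.ofLp = ‖x‖ ^ 2 := by
    rw [EuclideanSpace.real_norm_sq_eq]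
    simp [dotProduct, sq]
  rw [hhessian, lagrangianAngle_scalar_add_vecMulVec, smul_dotProduct, hdot, smul_eq_mul,
    div_mul_cancel₀ _ (pow_ne_zero 2 (norm_ne_zero_iff.2 hx)), add_sub_cancel]

theorem IsSingularProfile.lagrangianAngle_hessianMatrix {m : ℕ} {β : ℝ}
    (hh : IsSingularProfile m β r h) {x : EuclideanSpace ℝ (Fin (m + 1))}
    (hx : x ∈ Metric.ball 0 r \ {0}) :
    lagrangianAngle (hessianMatrix (radialPotential h) x) =
      (m + 1) * (Real.pi / 2) - β * (‖x‖ ^ 2 + ‖radialField h x‖ ^ 2) := by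
  have hnorm : ‖x‖ ∈ Set.Ioo 0 r := ⟨norm_pos_iff.2 hx.2, mem_ball_zero_iff.1 hx.1⟩
  rw [lagrangianAngle_hessianMatrix_radialPotential hh.continuous hh.map_zero hx.2
    (hh.hasDerivAt hnorm), hh.arctan_deriv _ hnorm, norm_radialField hh.map_zero, sq_abs]

theorem IsSingularProfile.isViscositySolution_radialPotential {m : ℕ} {β : ℝ}
    (hh : IsSingularProfile m β r h) :
    IsViscositySolution (rotatorPhase (-2 * β) ((m + 1) * (Real.pi / 2)))
      (Metric.ball (0 : EuclideanSpace ℝ (Fin (m + 1))) r) (radialPotential h) := by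
  have hgrad := gradient_radialPotential (E := EuclideanSpace ℝ (Fin (m + 1))) hh.continuous
    hh.map_zero
  refine isViscositySolution_of_isolated_singularity (p := 0)
    (fun x _ => (hasFDerivAt_radialPotential hh.continuous hh.map_zero x).differentiableAt)
    (fun x hx => ?_) (fun x hx => ?_)
    (fun φ => not_eventually_radialPotential_le hh.continuous hh.map_zero hh.tendsto_div) ?_
  · exact (contDiffOn_infty.1 (contDiffOn_radialPotential hh.continuous hh.contDiffOn) 2).contDiffAt
      ((Metric.isOpen_ball.sdiff isClosed_singleton).mem_nhds hx)
  · rw [hh.lagrangianAngle_hessianMatrix hx, rotatorPhase, hgrad]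
    ring
  · simp [rotatorPhase, hgrad, radialField]

theorem IsSingularProfile.isC1Holder_radialPotential {n m : ℕ} {β : ℝ}
    (hh : IsSingularProfile m β r h) :
    IsC1Holder (1 / 3) (Metric.ball (0 : EuclideanSpace ℝ (Fin n)) r) (radialPotential h) := by
  obtain ⟨C, hC⟩ := hh.exists_le_rpow
  refine isC1Holder_of_holderOnWith_gradient (C := 4 * C) Metric.isOpen_ball (by norm_num)
    (fun x _ => (hasFDerivAt_radialPotential hh.continuous hh.map_zero
      x).differentiableAt.differentiableWithinAt) ?_
  rw [gradient_radialPotential hh.continuous hh.map_zero]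
  exact holderOnWith_radialField ((div_le_one three_pos).2 (by norm_num)) hh.map_zero
    hh.strictMonoOn.monotoneOn hh.antitoneOn_div (by simpa using hC)

end Radial

theorem proposition6p1 (n : ℕ) (hn : 1 ≤ n) (a : ℝ) (ha : a < 0) (c : ℝ)
    (hc : c = n * Real.pi / 2) :
    ∃ r : ℝ, 0 < r ∧ ∃ u : EuclideanSpace ℝ (Fin n) → ℝ,
      IsViscositySolution (rotatorPhase a c) (Metric.ball 0 r) u ∧
      ConvexOn ℝ (Metric.ball 0 r) u ∧
      IsC1Holder (1 / 3) (Metric.ball 0 r) u ∧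
      ContDiffOn ℝ ∞ u (Metric.ball 0 r \ {0}) ∧
      ¬ DifferentiableAt ℝ (gradient u) 0 := by
  obtain ⟨m, rfl⟩ := Nat.exists_eq_add_of_le' hn
  obtain ⟨r, hr, h, hh⟩ := exists_isSingularProfile m (by linarith : 0 < -a / 2)
  refine ⟨r, hr, radialPotential h, ?_,
    convexOn_radialPotential hh.continuous hh.map_zero hh.strictMonoOn.monotoneOn,
    hh.isC1Holder_radialPotential, contDiffOn_radialPotential hh.continuous hh.contDiffOn, ?_⟩
  · have hphase : rotatorPhase a c =
        rotatorPhase (n := m + 1) (-2 * (-a / 2)) ((m + 1) * (Real.pi / 2)) := by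
      rw [hc, mul_div_assoc]
      congr 1
      · ring
      · push_cast
        rfl
    rw [hphase]
    exact hh.isViscositySolution_radialPotential
  · rw [gradient_radialPotential hh.continuous hh.map_zero]
    exact not_differentiableAt_radialField hh.tendsto_div
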